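/- **Setting.** Let $\mathcal X\subseteq\mathbb R^{n_x}$, $\mathcal U\subseteq\mathbb R^{n_u}$, $\Xi\subseteq\mathbb R^{n_\xi}$, let $g:\mathcal X\times\mathcal U\times\Xi\to\mathcal X$ and $l:\mathcal X\times\mathcal U\to[0,\infty)$ be Borel measurable, let $\gamma\in[0,1)$, and let $\xi_0,\xi_1,\dots$ be i.i.d. $\Xi$-valued random variables. For $x\in\mathcal X$ let $$V^*(x)=\inf_{\pi}\ \mathbb E\Big[\sum_{t=0}^\infty\gamma^t\,l(x_t,\pi(x_t))\Big],\qquad x_0=x,\quad x_{t+1}=g(x_t,\pi(x_t),\xi_t),$$ the infimum being over the measurable maps $\pi:\mathcal X\to\mathcal U$, and assume that $V^*(x)<\infty$ for all $x\in\mathcal X$. Put $(\mathcal T_uV)(x,u)=l(x,u)+\gamma\,\mathbb E[V(g(x,u,\xi))]$, with $\xi$ distributed as $\xi_0$. Let $\phi=(\phi_1,\dots,\phi_K):\mathcal X\to\mathbb R^K$ be continuous, one of the $\phi_k$ being the constant function $1$, with $\phi(g(x,u,\xi))$ integrable for all $x,u$. For a finite non-empty $A\subset\mathbb R^K$ let $V_A(x)=\max_{\alpha\in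 A}\alpha^\top\phi(x)$, and let $BI(A)\subseteq\mathbb R^K$ be a convex set such that every $\alpha\in BI(A)$ satisfies $\alpha^\top\phi(x)\le(\mathcal T_uV_A)(x,u)$ for all $x\in\mathcal X$, $u\in\mathcal U$. Let $x_{c,1},\dots,x_{c,N_c}\in\mathcal X$ with $N_c\ge1$. For a finite non-empty set $\mathcal A_{\rm obj}\subset\mathbb R^K$ put $$F(\mathcal A_{\rm obj})=\frac1{N_c}\sum_{i=1}^{N_c}V_{\mathcal A_{\rm obj}}(x_{c,i}),\qquad f_{\rm pwm}(\alpha)=\frac1{N_c}\sum_{i=1}^{N_c}\max\{\alpha^\top\phi(x_{c,i}),V_{\mathcal A_{\rm obj}}(x_{c,i})\}.$$ Let $\partial^+f=-\partial(-f)$ denote the general (limiting) upper subdifferential. *Algorithm 1*, with input $\alpha^{(0)},\mathcal A_{\rm obj},\mathcal A_{\rm con},\epsilon$: starting from $k=0$, choose any $d^{(k)}\in\partial^+f_{\rm pwm}(\alpha^{(k)})$; put $\alpha^{(k+1)}=\alpha^{(k)}$ if $d^{(k)}=0$, and otherwise let $\alpha^{(k+1)}$ be any maximizer of $\alpha^\top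 d^{(k)}$ over $\alpha\in BI(\mathcal A_{\rm con})$; increase $k$ by one; repeat until $f_{\rm pwm}(\alpha^{(k)})-f_{\rm pwm}(\alpha^{(k-1)})<\epsilon$, and return $\alpha^{(k)}$. *Algorithm 2*, with input $\mathcal A_{\rm obj},\mathcal A_{\rm con},\epsilon_{\rm IN},\epsilon_{\rm OUT}$: starting from $m=0$, put $f^{(m)}=F(\mathcal A_{\rm obj})$; for $i=1,\dots,N_c$ in turn, choose any maximizer $\alpha^{(0)}$ of $\alpha^\top\phi(x_{c,i})$ over $\alpha\in BI(\mathcal A_{\rm con})$, refine it by Algorithm 1 with the current sets and tolerance $\epsilon_{\rm IN}$ to $\tilde\alpha$, and add $\tilde\alpha$ to both $\mathcal A_{\rm obj}$ and $\mathcal A_{\rm con}$; then increase $m$ by one and put $f^{(m)}=F(\mathcal A_{\rm obj})$; repeat until $f^{(m)}-f^{(m-1)}<\epsilon_{\rm OUT}$, and return $\mathcal A_{\rm obj},\mathcal A_{\rm con}$. **Theorem.** Let $\epsilon_{\rm IN},\epsilon_{\rm OUT}>0$, and let the initial sets $\mathcal A_{\rm obj},\mathcal A_{\rm con}\subset\mathbb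 R^K$ be finite and non-empty with $V_{\mathcal A_{\rm obj}}\le V^*$ and $V_{\mathcal A_{\rm con}}\le V^*$ on $\mathcal X$. Assume that for every finite $A\supseteq\mathcal A_{\rm con}$ with $V_A\le V^*$ and every $i$ the problem $\max\{\alpha^\top\phi(x_{c,i}):\alpha\in BI(A)\}$ attains its maximum. Then, whatever choices are made: 1. Algorithm 2 stops after finitely many iterations: no execution of it, including the inner loops of Algorithm 1, is infinite. 2. Throughout every execution $F(\mathcal A_{\rm obj})$ is non-decreasing and at most $\frac1{N_c}\sum_{i=1}^{N_c}V^*(x_{c,i})$. 3. An execution can stop only by returning, or at a step of Algorithm 1 with $d^{(k)}\neq0$ at which $\alpha^\top d^{(k)}$ has no maximizer over $BI(\mathcal A_{\rm con})$. If, moreover, for all $A$ as above and all non-empty $I\subseteq\{1,\dots,N_c\}$ the problem $\max\{\sum_{i\in I}\alpha^\top\phi(x_{c,i}):\alpha\in BI(A)\}$ attains its maximum, then an execution can stop only by returning, so that Algorithm 2 always terminates and returns after finitely many iterations. -/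

import Mathlib

open MeasureTheory Filter Topology
open scoped ENNReal

noncomputable section

namespace PwmADP

/-! ### Stochastic optimal control problem -/

/-- Data of a discounted infinite-horizon stochastic optimal control problem with state set
`X ⊆ ℝ^nx`, action set `U ⊆ ℝ^nu`, disturbance set `Ξ ⊆ ℝ^nξ`, dynamics `g`, non-negative
stage cost `l`, discount factor `γ ∈ [0,1)`; the disturbances are i.i.d. with law `P`. -/
structure ControlProblem (nx nu nξ : ℕ) where
  X : Set (EuclideanSpace ℝ (Fin nx))
  U : Set (EuclideanSpace ℝ (Fin nu))
  Ξ : Set (EuclideanSpace ℝ (Fin nξ))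
  g : X → U → Ξ → X
  l : X → U → ℝ
  γ : ℝ
  P : Measure Ξ
  measurable_g : Measurable fun p : X × U × Ξ => g p.1 p.2.1 p.2.2
  measurable_l : Measurable fun p : X × U => l p.1 p.2
  l_nonneg : ∀ x u, 0 ≤ l x u
  γ_nonneg : 0 ≤ γ
  γ_lt_one : γ < 1
  isProb : IsProbabilityMeasure P

attribute [instance] ControlProblem.isProb

namespace ControlProblem

variable {nx nu nξ : ℕ} (M : ControlProblem nx nu nξ)

/-- State at time `t` under the policy `π` from `x`, for the disturbance sequence `ω`. -/
def traj (π : M.X → M.U) (x : M.X) (ω : ℕ → M.Ξ) : ℕ → M.X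
  | 0 => x
  | t + 1 => M.g (traj π x ω t) (π (traj π x ω t)) (ω t)

/-- Expected discounted cost of the policy `π` from `x`. The disturbance sequence is drawn from
the infinite product of `P`; the summands are non-negative, so the value lies in `[0,∞]`. -/
def cost (π : M.X → M.U) (x : M.X) : ℝ≥0∞ :=
  ∫⁻ ω, ∑' t : ℕ, ENNReal.ofReal (M.γ ^ t * M.l (M.traj π x ω t) (π (M.traj π x ω t)))
    ∂(Measure.infinitePi fun _ : ℕ => M.P)

/-- Infimum of the cost over the (measurable) deterministic Markov policies, in `[0,∞]`. -/
def optCost (x : M.X) : ℝ≥0∞ :=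
  ⨅ π : {π : M.X → M.U // Measurable π}, M.cost π.1 x

/-- The real-valued optimal value function; used only where `optCost` is finite. -/
def Vstar (x : M.X) : ℝ := (M.optCost x).toReal

/-- `(T_u V)(x,u) = l(x,u) + γ E[V(g(x,u,ξ))]`. -/
def bellman (V : M.X → ℝ) (x : M.X) (u : M.U) : ℝ :=
  M.l x u + M.γ * ∫ ξ, V (M.g x u ξ) ∂M.P

end ControlProblem

/-! ### Upper subdifferential -/

section Subdiff

variable {E : Type*} [NormedAddCommGroup E] [InnerProductSpace ℝ E]

/-- `d` is a regular lower subgradient of `f` at `x`: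
`liminf_{z → x, z ≠ x} (f z - f x - ⟨z - x, d⟩) / ‖z - x‖ ≥ 0`. -/
def IsRegularSubgradient (f : E → ℝ) (x d : E) : Prop :=
  ∀ ε : ℝ, 0 < ε → ∀ᶠ z in 𝓝[≠] x, -ε ≤ (f z - f x - inner ℝ (z - x) d) / ‖z - x‖

/-- The general lower subdifferential: limits of regular subgradients along `f`-attentive
sequences. -/
def lowerSubdiff (f : E → ℝ) (x : E) : Set E :=
  {d | ∃ y e : ℕ → E, Tendsto y atTop (𝓝 x) ∧ Tendsto (fun n => f (y n)) atTop (𝓝 (f x)) ∧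
    (∀ n, IsRegularSubgradient f (y n) (e n)) ∧ Tendsto e atTop (𝓝 d)}

/-- The general upper subdifferential `∂⁺ f (x) = -∂(-f)(x)`. -/
def upperSubdiff (f : E → ℝ) (x : E) : Set E :=
  {d | -d ∈ lowerSubdiff (fun y => -f y) x}

/-- `α` maximizes the linear functional `⟨·, d⟩` over `C`. -/
def IsLPMax (C : Set E) (d α : E) : Prop :=
  α ∈ C ∧ ∀ β ∈ C, inner ℝ β d ≤ inner ℝ α d

end Subdiff

/-! ### Point-wise maxima, and the two algorithms -/

section Algorithm

variable {X : Type*} {K N : ℕ}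

/-- Point-wise maximum `x ↦ max_{α ∈ A} αᵀ φ(x)`, for finite non-empty `A`. -/
def pwm (φ : X → EuclideanSpace ℝ (Fin K)) (A : Set (EuclideanSpace ℝ (Fin K))) (x : X) : ℝ :=
  sSup ((fun α => inner ℝ α (φ x)) '' A)

/-- `(1/N) ∑ᵢ max_{α ∈ A} αᵀ φ(xcᵢ)`. -/
def avgObj (φ : X → EuclideanSpace ℝ (Fin K)) (xc : Fin N → X)
    (A : Set (EuclideanSpace ℝ (Fin K))) : ℝ :=
  (1 / (N : ℝ)) * ∑ i, pwm φ A (xc i)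

/-- `f_pwm(α) = (1/N) ∑ᵢ max {αᵀ φ(xcᵢ), V_obj(xcᵢ)}`. -/
def fpwm (φ : X → EuclideanSpace ℝ (Fin K)) (xc : Fin N → X)
    (Aobj : Set (EuclideanSpace ℝ (Fin K))) (α : EuclideanSpace ℝ (Fin K)) : ℝ :=
  (1 / (N : ℝ)) * ∑ i, max (inner ℝ α (φ (xc i))) (pwm φ Aobj (xc i))

/-- Control points of the outer algorithm (with the inner procedure in-lined), together with the
current values of the program variables. -/
inductive State (K : ℕ)
  /-- Top of the outer repeat loop, iteration `m`. -/
  | outer (m : ℕ) (Aobj Acon : Set (EuclideanSpace ℝ (Fin K)))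
  /-- Top of the loop over the samples, at sample `i`; `fm` is the stored objective `f⁽ᵐ⁾`. -/
  | sample (m : ℕ) (fm : ℝ) (i : ℕ) (Aobj Acon : Set (EuclideanSpace ℝ (Fin K)))
  /-- Top of the inner repeat loop, iterate `α⁽ᵏ⁾ = α`. -/
  | inner (m : ℕ) (fm : ℝ) (i : ℕ) (Aobj Acon : Set (EuclideanSpace ℝ (Fin K)))
      (k : ℕ) (α : EuclideanSpace ℝ (Fin K))
  /-- Inner loop, after the subgradient `d⁽ᵏ⁾ = d` has been selected. -/
  | update (m : ℕ) (fm : ℝ) (i : ℕ) (Aobj Acon : Set (EuclideanSpace ℝ (Fin K)))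
      (k : ℕ) (α d : EuclideanSpace ℝ (Fin K))
  /-- The outer algorithm has returned. -/
  | returned (Aobj Acon : Set (EuclideanSpace ℝ (Fin K)))

/-- The current objective family `A_obj` of a state. -/
def State.Aobj : State K → Set (EuclideanSpace ℝ (Fin K))
  | .outer _ A _ => A
  | .sample _ _ _ A _ => A
  | .inner _ _ _ A _ _ _ => A
  | .update _ _ _ A _ _ _ _ => A
  | .returned A _ => A

/-- The next inner iterate: `α⁽ᵏ⁺¹⁾ = α⁽ᵏ⁾` if `d⁽ᵏ⁾ = 0`, else any maximizer of `αᵀ d⁽ᵏ⁾`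
over `C`. -/
def InnerUpdate (C : Set (EuclideanSpace ℝ (Fin K))) (α d α' : EuclideanSpace ℝ (Fin K)) : Prop :=
  (d = 0 ∧ α' = α) ∨ (d ≠ 0 ∧ IsLPMax C d α')

/-- One step of the outer algorithm. It is non-deterministic: any maximizer and any element of the
upper subdifferential may be selected. -/
inductive Step (φ : X → EuclideanSpace ℝ (Fin K)) (xc : Fin N → X)
    (BI : Set (EuclideanSpace ℝ (Fin K)) → Set (EuclideanSpace ℝ (Fin K))) (εin εout : ℝ) :
    State K → State K → Prop
  | start (m : ℕ) (Ao Ac : Set (EuclideanSpace ℝ (Fin K))) :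
      Step φ xc BI εin εout (.outer m Ao Ac) (.sample m (avgObj φ xc Ao) 0 Ao Ac)
  | generate (m : ℕ) (fm : ℝ) (i : ℕ) (Ao Ac : Set (EuclideanSpace ℝ (Fin K)))
      (α : EuclideanSpace ℝ (Fin K)) (hi : i < N)
      (hα : IsLPMax (BI Ac) (φ (xc ⟨i, hi⟩)) α) :
      Step φ xc BI εin εout (.sample m fm i Ao Ac) (.inner m fm i Ao Ac 0 α)
  | subgradient (m : ℕ) (fm : ℝ) (i : ℕ) (Ao Ac : Set (EuclideanSpace ℝ (Fin K)))
      (k : ℕ) (α d : EuclideanSpace ℝ (Fin K)) (hd : d ∈ upperSubdiff (fpwm φ xc Ao) α) :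
      Step φ xc BI εin εout (.inner m fm i Ao Ac k α) (.update m fm i Ao Ac k α d)
  | innerRepeat (m : ℕ) (fm : ℝ) (i : ℕ) (Ao Ac : Set (EuclideanSpace ℝ (Fin K)))
      (k : ℕ) (α d α' : EuclideanSpace ℝ (Fin K)) (hα : InnerUpdate (BI Ac) α d α')
      (hε : ¬ fpwm φ xc Ao α' - fpwm φ xc Ao α < εin) :
      Step φ xc BI εin εout (.update m fm i Ao Ac k α d) (.inner m fm i Ao Ac (k + 1) α')
  | innerReturn (m : ℕ) (fm : ℝ) (i : ℕ) (Ao Ac : Set (EuclideanSpace ℝ (Fin K)))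
      (k : ℕ) (α d α' : EuclideanSpace ℝ (Fin K)) (hα : InnerUpdate (BI Ac) α d α')
      (hε : fpwm φ xc Ao α' - fpwm φ xc Ao α < εin) :
      Step φ xc BI εin εout (.update m fm i Ao Ac k α d)
        (.sample m fm (i + 1) (insert α' Ao) (insert α' Ac))
  | outerRepeat (m : ℕ) (fm : ℝ) (Ao Ac : Set (EuclideanSpace ℝ (Fin K)))
      (hε : ¬ avgObj φ xc Ao - fm < εout) :
      Step φ xc BI εin εout (.sample m fm N Ao Ac) (.outer (m + 1) Ao Ac)
  | outerReturn (m : ℕ) (fm : ℝ) (Ao Ac : Set (EuclideanSpace ℝ (Fin K)))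
      (hε : avgObj φ xc Ao - fm < εout) :
      Step φ xc BI εin εout (.sample m fm N Ao Ac) (.returned Ao Ac)

/-- States that can be reached from the initial families. -/
def Reachable (φ : X → EuclideanSpace ℝ (Fin K)) (xc : Fin N → X)
    (BI : Set (EuclideanSpace ℝ (Fin K)) → Set (EuclideanSpace ℝ (Fin K))) (εin εout : ℝ)
    (Aobj Acon : Set (EuclideanSpace ℝ (Fin K))) (s : State K) : Prop :=
  Relation.ReflTransGen (Step φ xc BI εin εout) (.outer 0 Aobj Acon) s

end Algorithm

/-- `BI` assigns to each finite non-empty family `A` a convex inner approximation of the set of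
`α` with `αᵀ φ(x) ≤ (T_u V_A)(x,u)` for all `x`, `u`, where `V_A` is the point-wise maximum. -/
structure IsConvexInnerApprox {nx nu nξ K : ℕ} (M : ControlProblem nx nu nξ)
    (φ : M.X → EuclideanSpace ℝ (Fin K))
    (BI : Set (EuclideanSpace ℝ (Fin K)) → Set (EuclideanSpace ℝ (Fin K))) : Prop where
  convex : ∀ A : Set (EuclideanSpace ℝ (Fin K)), A.Finite → A.Nonempty → Convex ℝ (BI A)
  bellman_ineq : ∀ A : Set (EuclideanSpace ℝ (Fin K)), A.Finite → A.Nonempty → ∀ α ∈ BI A,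
    ∀ x u, inner ℝ α (φ x) ≤ M.bellman (pwm φ A) x u

end PwmADP

end

/-!
The Bellman inequality makes every `α ∈ BI A` a lower bound of `V*` as soon as the maximum over `A`
is one: for each policy, `bellman V_A` is at most the cost, by splitting the first disturbance off
the i.i.d. sequence. Hence both families stay below `V*` and the objectives are bounded by the
average of `V*`. Every repetition of a loop raises its objective by at least the tolerance, so a
lexicographic count of remaining outer iterations, samples and inner iterations strictly decreases.

The refinement objective is convex and piecewise affine. Rademacher's theorem provides limits of
gradients, so upper subgradients always exist. Conversely a regular upper subgradient must agree
with any global lower one, so all upper subgradients are among the finitely many vectors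
`(1/N) ∑ i ∈ I, φ (xc i)`, and the refinement programs are rescaled sums over sample points.
-/

noncomputable section

namespace PwmADP

section HeadTail

open ProbabilityTheory

lemma map_head_tail_infinitePi {Ω : ℕ → Type*} [∀ n, MeasurableSpace (Ω n)]
    (μ : ∀ n, Measure (Ω n)) [∀ n, IsProbabilityMeasure (μ n)] :
    (Measure.infinitePi μ).map (fun ω => (ω 0, fun n => ω (n + 1))) =
      (μ 0).prod (Measure.infinitePi fun n => μ (n + 1)) := by
  have hcoord : iIndepFun (fun n (ω : ∀ n, Ω n) => ω n) (Measure.infinitePi μ) :=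
    iIndepFun_infinitePi (X := fun _ ω => ω) fun _ => measurable_id
  have hindep : IndepFun (fun ω : ∀ n, Ω n => ω 0) (fun ω n => ω (n + 1))
      (Measure.infinitePi μ) := by
    have hdisj : Disjoint {0} {n : ℕ | n ≠ 0} := by simp
    refine indep_of_indep_of_le_left (indep_of_indep_of_le_right
      (indep_iSup_of_disjoint (fun n => (measurable_pi_apply n).comap_le) hcoord hdisj) ?_) ?_
    · simp only [MeasurableSpace.pi, MeasurableSpace.comap_iSup, MeasurableSpace.comap_comp]
      exact iSup_le fun n => le_iSup₂_of_le (n + 1) n.succ_ne_zero le_rfl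
    · exact le_iSup₂_of_le 0 rfl le_rfl
  rw [hindep.map_prod_eq_prod_map_map (measurable_pi_apply 0).aemeasurable
      (Measurable.aemeasurable (by fun_prop)), Measure.infinitePi_map_eval,
    Measure.map_infinitePi_infinitePi_of_inj (add_left_injective 1)]

lemma ofReal_integral_le_lintegral_ofReal {Ω : Type*} [MeasurableSpace Ω] {μ : Measure Ω}
    (f : Ω → ℝ) : ENNReal.ofReal (∫ ω, f ω ∂μ) ≤ ∫⁻ ω, ENNReal.ofReal (f ω) ∂μ := by
  by_cases hf : Integrable f μ
  · refine ENNReal.ofReal_le_of_le_toReal ?_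
    rw [integral_eq_lintegral_pos_part_sub_lintegral_neg_part hf]
    exact sub_le_self _ ENNReal.toReal_nonneg
  · simp [integral_undef hf]

end HeadTail

namespace ControlProblem

variable {nx nu nξ : ℕ} (M : ControlProblem nx nu nξ)

lemma traj_succ_eq_traj_tail (π : M.X → M.U) (x : M.X) (ω : ℕ → M.Ξ) (t : ℕ) :
    M.traj π x ω (t + 1) = M.traj π (M.g x (π x) (ω 0)) (fun n => ω (n + 1)) t := by
  induction t with
  | zero => rfl
  | succ t ih => rw [traj, ih]; rfl

/-- Discounted cost of the policy `π` from `x` along the disturbance sequence `ω`. -/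
def pathCost (π : M.X → M.U) (x : M.X) (ω : ℕ → M.Ξ) : ℝ≥0∞ :=
  ∑' t : ℕ, ENNReal.ofReal (M.γ ^ t * M.l (M.traj π x ω t) (π (M.traj π x ω t)))

lemma pathCost_eq_add_pathCost_tail (π : M.X → M.U) (x : M.X) (ω : ℕ → M.Ξ) :
    M.pathCost π x ω = ENNReal.ofReal (M.l x (π x)) +
      ENNReal.ofReal M.γ * M.pathCost π (M.g x (π x) (ω 0)) (fun n => ω (n + 1)) := by
  rw [pathCost, tsum_eq_zero_add' ENNReal.summable, pathCost, ← ENNReal.tsum_mul_left]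
  congr 1
  · rw [pow_zero, one_mul, traj]
  · refine tsum_congr fun t => ?_
    rw [traj_succ_eq_traj_tail, ← ENNReal.ofReal_mul M.γ_nonneg, pow_succ', mul_assoc]

variable {M} {π : M.X → M.U}

lemma measurable_traj (hπ : Measurable π) (t : ℕ) :
    Measurable fun p : M.X × (ℕ → M.Ξ) => M.traj π p.1 p.2 t := by
  induction t with
  | zero => exact measurable_fst
  | succ t ih =>
    exact M.measurable_g.comp
      (ih.prodMk ((hπ.comp ih).prodMk ((measurable_pi_apply t).comp measurable_snd)))

lemma measurable_pathCost (hπ : Measurable π) :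
    Measurable fun p : M.X × (ℕ → M.Ξ) => M.pathCost π p.1 p.2 := by
  refine Measurable.tsum fun t => ENNReal.measurable_ofReal.comp ?_
  have htraj := measurable_traj hπ t
  exact measurable_const.mul (M.measurable_l.comp (htraj.prodMk (hπ.comp htraj)))

lemma cost_eq_add_lintegral_cost (hπ : Measurable π) (x : M.X) :
    M.cost π x = ENNReal.ofReal (M.l x (π x)) +
      ENNReal.ofReal M.γ * ∫⁻ ξ, M.cost π (M.g x (π x) ξ) ∂M.P := by
  have hnext : Measurable fun ξ => M.g x (π x) ξ :=
    M.measurable_g.comp (by fun_prop : Measurable fun ξ => (x, π x, ξ))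
  have htail : Measurable fun p : M.Ξ × (ℕ → M.Ξ) => M.pathCost π (M.g x (π x) p.1) p.2 :=
    (measurable_pathCost hπ).comp ((hnext.comp measurable_fst).prodMk measurable_snd)
  have hsplit : Measurable fun ω : ℕ → M.Ξ => (ω 0, fun n => ω (n + 1)) := by fun_prop
  have htail_split : Measurable fun ω : ℕ → M.Ξ =>
      M.pathCost π (M.g x (π x) (ω 0)) (fun n => ω (n + 1)) := htail.comp hsplit
  calc M.cost π x
      = ∫⁻ ω, ENNReal.ofReal (M.l x (π x)) + ENNReal.ofReal M.γ *
          M.pathCost π (M.g x (π x) (ω 0)) (fun n => ω (n + 1))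
          ∂(Measure.infinitePi fun _ : ℕ => M.P) :=
        lintegral_congr (M.pathCost_eq_add_pathCost_tail π x)
    _ = ENNReal.ofReal (M.l x (π x)) + ENNReal.ofReal M.γ *
          ∫⁻ p, M.pathCost π (M.g x (π x) p.1) p.2
          ∂(Measure.infinitePi fun _ : ℕ => M.P).map (fun ω => (ω 0, fun n => ω (n + 1))) := by
        rw [lintegral_add_left measurable_const, lintegral_const, measure_univ, mul_one,
          lintegral_const_mul _ htail_split, lintegral_map htail hsplit]
    _ = ENNReal.ofReal (M.l x (π x)) +
          ENNReal.ofReal M.γ * ∫⁻ ξ, M.cost π (M.g x (π x) ξ) ∂M.P := by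
        rw [map_head_tail_infinitePi, lintegral_prod _ htail.aemeasurable]
        rfl

lemma bellman_le_cost (hπ : Measurable π) {V : M.X → ℝ}
    (hV : ∀ y, ENNReal.ofReal (V y) ≤ M.cost π y) (x : M.X) :
    ENNReal.ofReal (M.bellman V x (π x)) ≤ M.cost π x := by
  have hnext : ENNReal.ofReal (∫ ξ, V (M.g x (π x) ξ) ∂M.P) ≤
      ∫⁻ ξ, M.cost π (M.g x (π x) ξ) ∂M.P :=
    (ofReal_integral_le_lintegral_ofReal _).trans (lintegral_mono fun _ => hV _)
  rw [cost_eq_add_lintegral_cost hπ, bellman]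
  refine ENNReal.ofReal_add_le.trans ?_
  rw [ENNReal.ofReal_mul M.γ_nonneg]
  gcongr

lemma le_Vstar_of_le_bellman (hfin : ∀ x, M.optCost x ≠ ⊤) {V W : M.X → ℝ}
    (hV : ∀ x, V x ≤ M.Vstar x) (hW : ∀ x u, W x ≤ M.bellman V x u) (x : M.X) :
    W x ≤ M.Vstar x := by
  refine (ENNReal.ofReal_le_iff_le_toReal (hfin x)).1 (le_iInf fun π => ?_)
  have hVπ : ∀ y, ENNReal.ofReal (V y) ≤ M.cost π.1 y := fun y =>
    ((ENNReal.ofReal_le_iff_le_toReal (hfin y)).2 (hV y)).trans (iInf_le _ π)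
  exact (ENNReal.ofReal_le_ofReal (hW x (π.1 x))).trans (bellman_le_cost π.2 hVπ x)

end ControlProblem

section Subdiff

variable {E : Type*} [NormedAddCommGroup E] [InnerProductSpace ℝ E] {f g : E → ℝ} {x d e : E}

lemma isRegularSubgradient_iff : IsRegularSubgradient f x d ↔
    ∀ ε : ℝ, 0 < ε → ∀ᶠ z in 𝓝 x, f x + inner ℝ (z - x) d - ε * ‖z - x‖ ≤ f z := by
  refine forall₂_congr fun ε _ => ?_
  rw [eventually_nhdsWithin_iff]
  refine eventually_congr (.of_forall fun z => ?_)
  rcases eq_or_ne z x with rfl | hz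
  · simp
  · have hpos : 0 < ‖z - x‖ := norm_pos_iff.2 (sub_ne_zero.2 hz)
    simp only [Set.mem_compl_iff, Set.mem_singleton_iff, hz, not_false_eq_true, forall_const,
      le_div_iff₀ hpos]
    constructor <;> intro h <;> linarith

lemma isRegularSubgradient_of_forall_le (h : ∀ z, f x + inner ℝ (z - x) d ≤ f z) :
    IsRegularSubgradient f x d :=
  isRegularSubgradient_iff.2 fun ε hε => .of_forall fun z =>
    (sub_le_self _ (by positivity)).trans (h z)

lemma isRegularSubgradient_of_hasGradientAt [CompleteSpace E] (h : HasGradientAt f d x) :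
    IsRegularSubgradient f x d := by
  refine isRegularSubgradient_iff.2 fun ε hε => ?_
  filter_upwards [(hasGradientAt_iff_isLittleO.1 h).bound hε] with z hz
  rw [real_inner_comm] at hz
  linarith [neg_le_of_abs_le hz]

lemma IsRegularSubgradient.add (hf : IsRegularSubgradient f x d)
    (hg : IsRegularSubgradient g x e) :
    IsRegularSubgradient (fun z => f z + g z) x (d + e) := by
  rw [isRegularSubgradient_iff] at *
  intro ε hε
  filter_upwards [hf _ (half_pos hε), hg _ (half_pos hε)] with z hfz hgz
  rw [inner_add_right]
  linarith

lemma IsRegularSubgradient.eq_zero_of_const {c : ℝ}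
    (h : IsRegularSubgradient (fun _ => c) x d) : d = 0 := by
  by_contra hd
  have hnorm : 0 < ‖d‖ := norm_pos_iff.2 hd
  have hray : Tendsto (fun t : ℝ => x + t • d) (𝓝[>] 0) (𝓝 x) := by
    have hcont : Continuous fun t : ℝ => x + t • d := by fun_prop
    simpa using (hcont.tendsto 0).mono_left nhdsWithin_le_nhds
  obtain ⟨t, hle, ht⟩ := ((hray.eventually (isRegularSubgradient_iff.1 h _ (half_pos hnorm))).and
    self_mem_nhdsWithin).exists
  have ht : 0 < t := ht
  rw [add_sub_cancel_left, real_inner_smul_left, real_inner_self_eq_norm_mul_norm, norm_smul,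
    Real.norm_of_nonneg ht.le] at hle
  have : 0 < t * (‖d‖ * ‖d‖) := by positivity
  linarith

lemma IsRegularSubgradient.add_eq_zero (hd : IsRegularSubgradient f x d)
    (he : IsRegularSubgradient (fun z => -f z) x e) : d + e = 0 := by
  have h := hd.add he
  simp only [add_neg_cancel] at h
  exact h.eq_zero_of_const

lemma upperSubdiff_subset_of_isClosed {D : Set E} (hD : IsClosed D)
    (h : ∀ y, ∃ d ∈ D, IsRegularSubgradient f y d) (x : E) : upperSubdiff f x ⊆ D := by
  rintro d ⟨y, e, -, -, he, hlim⟩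
  have hmem : ∀ n, -e n ∈ D := fun n => by
    obtain ⟨w, hwD, hw⟩ := h (y n)
    rwa [← eq_neg_of_add_eq_zero_left (hw.add_eq_zero (he n))]
  exact hD.mem_of_tendsto (by simpa using hlim.neg) (.of_forall hmem)

lemma convexOn_univ_of_forall_exists_subgradient
    (h : ∀ y, ∃ d, ∀ z, f y + inner ℝ (z - y) d ≤ f z) : ConvexOn ℝ Set.univ f := by
  refine ⟨convex_univ, fun u _ v _ a b ha hb hab => ?_⟩
  obtain ⟨d, hd⟩ := h (a • u + b • v)
  have hcancel : a * inner ℝ (u - (a • u + b • v)) d + b * inner ℝ (v - (a • u + b • v)) d = 0 := by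
    rw [← real_inner_smul_left, ← real_inner_smul_left, ← inner_add_left]
    obtain rfl : b = 1 - a := by linarith
    convert inner_zero_left d using 2
    module
  calc f (a • u + b • v)
      = a * (f (a • u + b • v) + inner ℝ (u - (a • u + b • v)) d) +
          b * (f (a • u + b • v) + inner ℝ (v - (a • u + b • v)) d) := by
        linear_combination (-f (a • u + b • v)) * hab - hcancel
    _ ≤ a • f u + b • f v := by
        rw [smul_eq_mul, smul_eq_mul]
        gcongr
        exacts [hd u, hd v]

lemma IsLPMax.smul {C : Set E} {α : E} (h : IsLPMax C d α) {c : ℝ} (hc : 0 ≤ c) :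
    IsLPMax C (c • d) α := by
  refine ⟨h.1, fun β hβ => ?_⟩
  rw [real_inner_smul_right, real_inner_smul_right]
  exact mul_le_mul_of_nonneg_left (h.2 β hβ) hc

section FiniteDimensional

variable [FiniteDimensional ℝ E] {K : NNReal} {s : Set E}

/-- By Rademacher's theorem `x` is a limit of points of differentiability, where the gradients are
bounded by `K`; the limit of a convergent subsequence of them is a subgradient at `x`. -/
lemma lowerSubdiff_nonempty_of_lipschitzOnWith (hf : LipschitzOnWith K f s) (hs : s ∈ 𝓝 x) :
    (lowerSubdiff f x).Nonempty := by
  borelize E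
  have hdense : Dense {z | z ∈ s → DifferentiableWithinAt ℝ f s z} :=
    Measure.dense_of_ae (hf.ae_differentiableWithinAt_of_mem (μ := Measure.addHaar))
  obtain ⟨y, hy, hlim⟩ := mem_closure_iff_seq_limit.1
    (hdense.open_subset_closure_inter isOpen_interior (mem_interior_iff_mem_nhds.2 hs))
  have hnhds : ∀ n, s ∈ 𝓝 (y n) := fun n => mem_interior_iff_mem_nhds.1 (hy n).1
  have hdiff : ∀ n, DifferentiableAt ℝ f (y n) := fun n =>
    ((hy n).2 (mem_of_mem_nhds (hnhds n))).differentiableAt (hnhds n)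
  have hbound : ∀ n, gradient f (y n) ∈ Metric.closedBall (0 : E) K := fun n => by
    rw [mem_closedBall_zero_iff, gradient, LinearIsometryEquiv.norm_map]
    exact norm_fderiv_le_of_lipschitzOn ℝ (hnhds n) hf
  obtain ⟨d, -, ψ, hψ, hd⟩ := (isCompact_closedBall (0 : E) K).tendsto_subseq hbound
  have hyψ : Tendsto (y ∘ ψ) atTop (𝓝 x) := hlim.comp hψ.tendsto_atTop
  exact ⟨d, y ∘ ψ, fun n => gradient f (y (ψ n)), hyψ,
    (hf.continuousOn.continuousAt hs).tendsto.comp hyψ,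
    fun n => isRegularSubgradient_of_hasGradientAt (hdiff (ψ n)).hasGradientAt, hd⟩

lemma upperSubdiff_nonempty_of_locallyLipschitz (hf : LocallyLipschitz f) (x : E) :
    (upperSubdiff f x).Nonempty := by
  obtain ⟨K, s, hs, hfs⟩ := hf x
  obtain ⟨d, hd⟩ := lowerSubdiff_nonempty_of_lipschitzOnWith hfs.neg hs
  exact ⟨-d, by rwa [upperSubdiff, Set.mem_ofPred_eq, neg_neg]⟩

end FiniteDimensional

end Subdiff

section Pwm

variable {X : Type*} {K N : ℕ} {φ : X → EuclideanSpace ℝ (Fin K)} {xc : Fin N → X} {V : X → ℝ}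
  {A B C : Set (EuclideanSpace ℝ (Fin K))} {α d : EuclideanSpace ℝ (Fin K)}

lemma inner_le_pwm (hA : A.Finite) (hα : α ∈ A) (x : X) : inner ℝ α (φ x) ≤ pwm φ A x :=
  le_csSup (hA.image _).bddAbove (Set.mem_image_of_mem _ hα)

lemma pwm_le (hA : A.Nonempty) {x : X} {c : ℝ} (h : ∀ α ∈ A, inner ℝ α (φ x) ≤ c) :
    pwm φ A x ≤ c :=
  csSup_le (hA.image _) (Set.forall_mem_image.2 h)

lemma pwm_mono (hA : A.Nonempty) (hB : B.Finite) (h : A ⊆ B) (x : X) : pwm φ A x ≤ pwm φ B x :=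
  pwm_le hA fun _ hα => inner_le_pwm hB (h hα) x

lemma pwm_insert_le (hA : A.Finite) {x : X} {c : ℝ} (hα : inner ℝ α (φ x) ≤ c)
    (hc : pwm φ A x ≤ c) : pwm φ (insert α A) x ≤ c :=
  pwm_le (Set.insert_nonempty _ _) <| Set.forall_mem_insert.2
    ⟨hα, fun _ hβ => (inner_le_pwm hA hβ x).trans hc⟩

lemma avgObj_mono (hA : A.Nonempty) (hB : B.Finite) (h : A ⊆ B) :
    avgObj φ xc A ≤ avgObj φ xc B :=
  mul_le_mul_of_nonneg_left (Finset.sum_le_sum fun _ _ => pwm_mono hA hB h _) (by positivity)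

lemma avgObj_le (h : ∀ x, pwm φ A x ≤ V x) :
    avgObj φ xc A ≤ (1 / (N : ℝ)) * ∑ i, V (xc i) :=
  mul_le_mul_of_nonneg_left (Finset.sum_le_sum fun _ _ => h _) (by positivity)

lemma fpwm_le (h : ∀ x, pwm φ A x ≤ V x) (hα : ∀ x, inner ℝ α (φ x) ≤ V x) :
    fpwm φ xc A α ≤ (1 / (N : ℝ)) * ∑ i, V (xc i) :=
  mul_le_mul_of_nonneg_left (Finset.sum_le_sum fun _ _ => max_le (hα _) (h _)) (by positivity)

lemma exists_finset_fpwm_add_inner_le (y : EuclideanSpace ℝ (Fin K)) :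
    ∃ I : Finset (Fin N), ∀ z,
      fpwm φ xc A y + inner ℝ (z - y) ((1 / (N : ℝ)) • ∑ i ∈ I, φ (xc i)) ≤ fpwm φ xc A z := by
  classical
  refine ⟨Finset.univ.filter fun i => pwm φ A (xc i) ≤ inner ℝ y (φ (xc i)), fun z => ?_⟩
  rw [fpwm, fpwm, real_inner_smul_right, ← mul_add, inner_sum, Finset.sum_filter,
    ← Finset.sum_add_distrib]
  refine mul_le_mul_of_nonneg_left (Finset.sum_le_sum fun i _ => ?_) (by positivity)
  split_ifs with hi
  · rw [max_eq_left hi, inner_sub_left, add_sub_cancel]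
    exact le_max_left _ _
  · rw [max_eq_right (not_le.1 hi).le, add_zero]
    exact le_max_right _ _

lemma upperSubdiff_fpwm_nonempty (α : EuclideanSpace ℝ (Fin K)) :
    (upperSubdiff (fpwm φ xc A) α).Nonempty :=
  upperSubdiff_nonempty_of_locallyLipschitz (convexOn_univ_of_forall_exists_subgradient fun y =>
    (exists_finset_fpwm_add_inner_le y).imp' _ fun _ h => h).locallyLipschitz α

lemma upperSubdiff_fpwm_subset (α : EuclideanSpace ℝ (Fin K)) :
    upperSubdiff (fpwm φ xc A) α ⊆
      Set.range fun I : Finset (Fin N) => (1 / (N : ℝ)) • ∑ i ∈ I, φ (xc i) := by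
  refine upperSubdiff_subset_of_isClosed (Set.finite_range _).isClosed (fun y => ?_) α
  obtain ⟨I, hI⟩ := exists_finset_fpwm_add_inner_le (φ := φ) (xc := xc) (A := A) y
  exact ⟨_, Set.mem_range_self I, isRegularSubgradient_of_forall_le hI⟩

lemma exists_isLPMax_of_mem_upperSubdiff_fpwm
    (hC : ∀ I : Finset (Fin N), I.Nonempty → ∃ β, IsLPMax C (∑ i ∈ I, φ (xc i)) β)
    (hd : d ∈ upperSubdiff (fpwm φ xc A) α) (hd0 : d ≠ 0) : ∃ β, IsLPMax C d β := by
  obtain ⟨I, rfl⟩ := upperSubdiff_fpwm_subset α hd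
  have hI : I.Nonempty := Finset.nonempty_iff_ne_empty.2 fun h => hd0 (by simp [h])
  obtain ⟨β, hβ⟩ := hC I hI
  exact ⟨β, hβ.smul (by positivity)⟩

lemma InnerUpdate.mem {α' : EuclideanSpace ℝ (Fin K)} (h : InnerUpdate C α d α') (hα : α ∈ C) :
    α' ∈ C := by
  rcases h with ⟨-, rfl⟩ | ⟨-, h⟩
  exacts [hα, h.1]

lemma exists_innerUpdate (h : d ≠ 0 → ∃ β, IsLPMax C d β) : ∃ α', InnerUpdate C α d α' := by
  by_cases hd : d = 0
  · exact ⟨α, .inl ⟨hd, rfl⟩⟩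
  · exact (h hd).imp fun β hβ => .inr ⟨hd, hβ⟩

end Pwm

section LowerBounds

variable {X : Type*} {K : ℕ}

/-- Finite non-empty families whose point-wise maximum is a lower bound of `V`. -/
structure IsLowerFamily (φ : X → EuclideanSpace ℝ (Fin K)) (V : X → ℝ)
    (A : Set (EuclideanSpace ℝ (Fin K))) : Prop where
  finite : A.Finite
  nonempty : A.Nonempty
  pwm_le : ∀ x, pwm φ A x ≤ V x

/-- From a family below `V` the map `BI` only generates lower bounds of `V`. For `V = V*` this is
all that the analysis of the algorithms retains of the Bellman inequality. -/
def PreservesLowerBounds (φ : X → EuclideanSpace ℝ (Fin K)) (V : X → ℝ)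
    (BI : Set (EuclideanSpace ℝ (Fin K)) → Set (EuclideanSpace ℝ (Fin K))) : Prop :=
  ∀ ⦃A⦄, IsLowerFamily φ V A → ∀ ⦃α⦄, α ∈ BI A → ∀ x, inner ℝ α (φ x) ≤ V x

lemma IsLowerFamily.insert {φ : X → EuclideanSpace ℝ (Fin K)} {V : X → ℝ}
    {A : Set (EuclideanSpace ℝ (Fin K))} (hA : IsLowerFamily φ V A)
    {α : EuclideanSpace ℝ (Fin K)} (hα : ∀ x, inner ℝ α (φ x) ≤ V x) :
    IsLowerFamily φ V (insert α A) :=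
  ⟨hA.finite.insert α, Set.insert_nonempty _ _,
    fun x => pwm_insert_le hA.finite (hα x) (hA.pwm_le x)⟩

lemma IsConvexInnerApprox.preservesLowerBounds {nx nu nξ : ℕ} {M : ControlProblem nx nu nξ}
    {φ : M.X → EuclideanSpace ℝ (Fin K)}
    {BI : Set (EuclideanSpace ℝ (Fin K)) → Set (EuclideanSpace ℝ (Fin K))}
    (hBI : IsConvexInnerApprox M φ BI) (hfin : ∀ x, M.optCost x ≠ ⊤) :
    PreservesLowerBounds φ M.Vstar BI := fun A hA α hα =>
  ControlProblem.le_Vstar_of_le_bellman hfin hA.pwm_le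
    (hBI.bellman_ineq A hA.finite hA.nonempty α hα)

end LowerBounds

/-- The number of increments of size at least `ε` by which an objective of value `f` can still
grow without exceeding `B`. -/
def stepsLeft (B ε f : ℝ) : ℕ := ⌊(B - f) / ε⌋₊

lemma stepsLeft_lt_stepsLeft {B ε f f' : ℝ} (hε : 0 < ε) (h : ¬ f' - f < ε) (hf' : f' ≤ B) :
    stepsLeft B ε f' < stepsLeft B ε f := by
  have hstep : (B - f') / ε + 1 ≤ (B - f) / ε := by
    rw [div_add_one hε.ne']
    gcongr
    linarith
  calc stepsLeft B ε f' < stepsLeft B ε f' + 1 := Nat.lt_succ_self _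
    _ = ⌊(B - f') / ε + 1⌋₊ :=
        (Nat.floor_add_one (div_nonneg (sub_nonneg.2 hf') hε.le)).symm
    _ ≤ stepsLeft B ε f := Nat.floor_le_floor hstep

section Execution

variable {X : Type*} {K N : ℕ} (φ : X → EuclideanSpace ℝ (Fin K)) (xc : Fin N → X)
  (BI : Set (EuclideanSpace ℝ (Fin K)) → Set (EuclideanSpace ℝ (Fin K))) (εin εout : ℝ)
  (Acon : Set (EuclideanSpace ℝ (Fin K))) (V : X → ℝ)

/-- The invariant of the two families maintained by the algorithm started from the constraint
family `Acon`. -/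
structure ValidFamilies (Ao Ac : Set (EuclideanSpace ℝ (Fin K))) : Prop where
  obj : IsLowerFamily φ V Ao
  con : IsLowerFamily φ V Ac
  subset : Acon ⊆ Ac

/-- The invariant of the program states. -/
def ValidState : State K → Prop
  | .outer _ Ao Ac => ValidFamilies φ Acon V Ao Ac
  | .sample _ _ i Ao Ac => ValidFamilies φ Acon V Ao Ac ∧ i ≤ N
  | .inner _ _ i Ao Ac _ α => ValidFamilies φ Acon V Ao Ac ∧ i < N ∧ α ∈ BI Ac
  | .update _ _ i Ao Ac _ α d => ValidFamilies φ Acon V Ao Ac ∧ i < N ∧ α ∈ BI Ac ∧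
      d ∈ upperSubdiff (fpwm φ xc Ao) α
  | .returned Ao Ac => ValidFamilies φ Acon V Ao Ac

/-- The lexicographic termination measure, for objectives bounded by `B`: remaining outer
iterations, samples and inner iterations. The factors `2` and offsets make room for the steps
between two consecutive control points of the same loop. -/
def rank (B : ℝ) : State K → ℕ ×ₗ ℕ ×ₗ ℕ
  | .outer _ Ao _ => toLex (stepsLeft B εout (avgObj φ xc Ao), toLex (2 * N + 2, 0))
  | .sample _ fm i _ _ => toLex (stepsLeft B εout fm, toLex (2 * (N - i) + 1, 0))
  | .inner _ fm i Ao _ _ α => toLex (stepsLeft B εout fm,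
      toLex (2 * (N - i), 2 * stepsLeft B εin (fpwm φ xc Ao α) + 1))
  | .update _ fm i Ao _ _ α _ => toLex (stepsLeft B εout fm,
      toLex (2 * (N - i), 2 * stepsLeft B εin (fpwm φ xc Ao α)))
  | .returned _ _ => toLex (0, toLex (0, 0))

variable {φ xc BI εin εout Acon V} {Aobj : Set (EuclideanSpace ℝ (Fin K))} {s s' : State K}

lemma ValidState.validFamilies (hs : ValidState φ xc BI Acon V s) :
    ∃ Ac, ValidFamilies φ Acon V s.Aobj Ac := by
  cases s with
  | outer => exact ⟨_, hs⟩
  | returned => exact ⟨_, hs⟩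
  | sample => exact ⟨_, hs.1⟩
  | inner => exact ⟨_, hs.1⟩
  | update => exact ⟨_, hs.1⟩

lemma ValidState.avgObj_le (hs : ValidState φ xc BI Acon V s) :
    avgObj φ xc s.Aobj ≤ (1 / (N : ℝ)) * ∑ i, V (xc i) :=
  let ⟨_, h⟩ := hs.validFamilies
  PwmADP.avgObj_le h.obj.pwm_le

lemma Step.aobj_subset (h : Step φ xc BI εin εout s s') : s.Aobj ⊆ s'.Aobj := by
  cases h with
  | innerReturn => exact Set.subset_insert _ _
  | _ => exact subset_rfl

lemma ValidState.step (hBI : PreservesLowerBounds φ V BI) (hs : ValidState φ xc BI Acon V s)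
    (h : Step φ xc BI εin εout s s') : ValidState φ xc BI Acon V s' := by
  cases h with
  | start => exact ⟨hs, N.zero_le⟩
  | generate _ _ _ _ _ _ hi hα => exact ⟨hs.1, hi, hα.1⟩
  | subgradient _ _ _ _ _ _ _ _ hd => exact ⟨hs.1, hs.2.1, hs.2.2, hd⟩
  | innerRepeat _ _ _ _ _ _ _ _ _ hα => exact ⟨hs.1, hs.2.1, hα.mem hs.2.2.1⟩
  | innerReturn _ _ _ _ _ _ _ _ _ hα =>
    have hlow := hBI hs.1.con (hα.mem hs.2.2.1)
    exact ⟨⟨hs.1.obj.insert hlow, hs.1.con.insert hlow,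
      hs.1.subset.trans (Set.subset_insert _ _)⟩, hs.2.1⟩
  | outerRepeat => exact hs.1
  | outerReturn => exact hs.1

lemma Reachable.validState (hBI : PreservesLowerBounds φ V BI)
    (h₀ : ValidFamilies φ Acon V Aobj Acon) (hs : Reachable φ xc BI εin εout Aobj Acon s) :
    ValidState φ xc BI Acon V s := by
  induction hs with
  | refl => exact h₀
  | tail _ h ih => exact ih.step hBI h

lemma avgObj_le_of_step (hBI : PreservesLowerBounds φ V BI) (hs : ValidState φ xc BI Acon V s)
    (h : Step φ xc BI εin εout s s') : avgObj φ xc s.Aobj ≤ avgObj φ xc s'.Aobj := by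
  obtain ⟨_, hv⟩ := hs.validFamilies
  obtain ⟨_, hv'⟩ := (hs.step hBI h).validFamilies
  exact avgObj_mono hv.obj.nonempty hv'.obj.finite h.aobj_subset

lemma rank_lt_rank_of_step (hBI : PreservesLowerBounds φ V BI) (hεin : 0 < εin)
    (hεout : 0 < εout) (hs : ValidState φ xc BI Acon V s) (h : Step φ xc BI εin εout s s') :
    rank φ xc εin εout ((1 / (N : ℝ)) * ∑ i, V (xc i)) s' <
      rank φ xc εin εout ((1 / (N : ℝ)) * ∑ i, V (xc i)) s := by
  cases h with
  | start => simp [rank, Prod.Lex.toLex_lt_toLex]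
  | generate => simp [rank, Prod.Lex.toLex_lt_toLex]
  | subgradient => simp [rank, Prod.Lex.toLex_lt_toLex]
  | innerRepeat _ _ _ _ _ _ _ _ _ hα hε =>
    have hdec := stepsLeft_lt_stepsLeft hεin hε
      (fpwm_le (xc := xc) hs.1.obj.pwm_le (hBI hs.1.con (hα.mem hs.2.2.1)))
    exact Prod.Lex.toLex_lt_toLex.2 (.inr ⟨rfl, Prod.Lex.toLex_lt_toLex.2
      (.inr ⟨rfl, by dsimp only; omega⟩)⟩)
  | innerReturn =>
    have hi := hs.2.1
    exact Prod.Lex.toLex_lt_toLex.2 (.inr ⟨rfl, Prod.Lex.toLex_lt_toLex.2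
      (.inl (by dsimp only; omega))⟩)
  | outerRepeat _ _ _ _ hε =>
    exact Prod.Lex.toLex_lt_toLex.2 (.inl (stepsLeft_lt_stepsLeft hεout hε hs.avgObj_le))
  | outerReturn =>
    simp only [rank, Prod.Lex.toLex_lt_toLex]
    omega

lemma not_exists_infinite_execution (hBI : PreservesLowerBounds φ V BI) (hεin : 0 < εin)
    (hεout : 0 < εout) {s₀ : State K} (h₀ : ValidState φ xc BI Acon V s₀) :
    ¬ ∃ s : ℕ → State K, s 0 = s₀ ∧ ∀ n, Step φ xc BI εin εout (s n) (s (n + 1)) := by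
  rintro ⟨s, rfl, hs⟩
  have hvalid : ∀ n, ValidState φ xc BI Acon V (s n) := fun n => by
    induction n with
    | zero => exact h₀
    | succ n ih => exact ih.step hBI (hs n)
  exact not_strictAnti_of_wellFoundedLT
    (fun n => rank φ xc εin εout ((1 / (N : ℝ)) * ∑ i, V (xc i)) (s n))
    (strictAnti_nat_of_succ_lt fun n => rank_lt_rank_of_step hBI hεin hεout (hvalid n) (hs n))

lemma ValidState.exists_step_or_returned_or_not_exists_isLPMax
    (hLP : ∀ A, Acon ⊆ A → IsLowerFamily φ V A → ∀ i, ∃ α, IsLPMax (BI A) (φ (xc i)) α)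
    (hs : ValidState φ xc BI Acon V s) :
    (∃ s', Step φ xc BI εin εout s s') ∨ (∃ Ao Ac, s = State.returned Ao Ac) ∨
      (∃ m fm i Ao Ac k α d, s = State.update m fm i Ao Ac k α d ∧ d ≠ 0 ∧
        ¬ ∃ β, IsLPMax (BI Ac) d β) := by
  cases s with
  | outer m Ao Ac => exact .inl ⟨_, .start m Ao Ac⟩
  | returned Ao Ac => exact .inr (.inl ⟨Ao, Ac, rfl⟩)
  | sample m fm i Ao Ac =>
    left
    rcases hs.2.lt_or_eq with hi | rfl
    · obtain ⟨α, hα⟩ := hLP Ac hs.1.subset hs.1.con ⟨i, hi⟩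
      exact ⟨_, .generate m fm i Ao Ac α hi hα⟩
    · by_cases hε : avgObj φ xc Ao - fm < εout
      · exact ⟨_, .outerReturn m fm Ao Ac hε⟩
      · exact ⟨_, .outerRepeat m fm Ao Ac hε⟩
  | inner m fm i Ao Ac k α =>
    obtain ⟨d, hd⟩ := upperSubdiff_fpwm_nonempty (φ := φ) (xc := xc) (A := Ao) α
    exact .inl ⟨_, .subgradient m fm i Ao Ac k α d hd⟩
  | update m fm i Ao Ac k α d =>
    by_cases hd : d ≠ 0 → ∃ β, IsLPMax (BI Ac) d β
    · obtain ⟨α', hα'⟩ := exists_innerUpdate (α := α) hd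
      left
      by_cases hε : fpwm φ xc Ao α' - fpwm φ xc Ao α < εin
      · exact ⟨_, .innerReturn m fm i Ao Ac k α d α' hα' hε⟩
      · exact ⟨_, .innerRepeat m fm i Ao Ac k α d α' hα' hε⟩
    · exact .inr (.inr ⟨m, fm, i, Ao, Ac, k, α, d, rfl, Classical.not_imp.1 hd⟩)

end Execution

end PwmADP

end

open PwmADP in
theorem mainTheorem3_general {X : Type*} {K N : ℕ} {V : X → ℝ}
    {φ : X → EuclideanSpace ℝ (Fin K)}
    {BI : Set (EuclideanSpace ℝ (Fin K)) → Set (EuclideanSpace ℝ (Fin K))}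
    (hBI : PreservesLowerBounds φ V BI) (xc : Fin N → X)
    {Aobj Acon : Set (EuclideanSpace ℝ (Fin K))}
    (hobj : IsLowerFamily φ V Aobj) (hcon : IsLowerFamily φ V Acon)
    (hLP : ∀ A : Set (EuclideanSpace ℝ (Fin K)), Acon ⊆ A → A.Finite →
      (∀ x, pwm φ A x ≤ V x) → ∀ i, ∃ α, IsLPMax (BI A) (φ (xc i)) α)
    {εin εout : ℝ} (hεin : 0 < εin) (hεout : 0 < εout) :
    (¬ ∃ s : ℕ → State K, s 0 = State.outer 0 Aobj Acon ∧
      ∀ n, Step φ xc BI εin εout (s n) (s (n + 1))) ∧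
    (∀ s, Reachable φ xc BI εin εout Aobj Acon s →
      avgObj φ xc s.Aobj ≤ (1 / (N : ℝ)) * ∑ i, V (xc i) ∧
      ∀ s', Step φ xc BI εin εout s s' → avgObj φ xc s.Aobj ≤ avgObj φ xc s'.Aobj) ∧
    (∀ s, Reachable φ xc BI εin εout Aobj Acon s →
      (∃ s', Step φ xc BI εin εout s s') ∨ (∃ Ao Ac, s = State.returned Ao Ac) ∨
      (∃ m fm i Ao Ac k α d, s = State.update m fm i Ao Ac k α d ∧ d ≠ 0 ∧
        ¬ ∃ β, IsLPMax (BI Ac) d β)) ∧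
    ((∀ A : Set (EuclideanSpace ℝ (Fin K)), Acon ⊆ A → A.Finite →
        (∀ x, pwm φ A x ≤ V x) → ∀ I : Finset (Fin N), I.Nonempty →
        ∃ α, IsLPMax (BI A) (∑ i ∈ I, φ (xc i)) α) →
      ∀ s, Reachable φ xc BI εin εout Aobj Acon s →
        (∃ s', Step φ xc BI εin εout s s') ∨ ∃ Ao Ac, s = State.returned Ao Ac) := by
  have h₀ : ValidFamilies φ Acon V Aobj Acon := ⟨hobj, hcon, subset_rfl⟩
  have hvalid : ∀ s, Reachable φ xc BI εin εout Aobj Acon s → ValidState φ xc BI Acon V s :=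
    fun s hs => hs.validState hBI h₀
  have hprogress : ∀ s, Reachable φ xc BI εin εout Aobj Acon s → _ := fun s hs =>
    (hvalid s hs).exists_step_or_returned_or_not_exists_isLPMax (εin := εin) (εout := εout)
      fun A hsub hA => hLP A hsub hA.finite hA.pwm_le
  refine ⟨not_exists_infinite_execution hBI hεin hεout h₀,
    fun s hs => ⟨(hvalid s hs).avgObj_le, fun s' => avgObj_le_of_step hBI (hvalid s hs)⟩,
    hprogress, fun hsum s hs => ?_⟩
  rcases hprogress s hs with hstep | hret | ⟨m, fm, i, Ao, Ac, k, α, d, rfl, hd0, hnot⟩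
  · exact .inl hstep
  · exact .inr hret
  · obtain ⟨hF, -, -, hd⟩ := hvalid _ hs
    exact absurd (exists_isLPMax_of_mem_upperSubdiff_fpwm
      (hsum Ac hF.subset hF.con.finite hF.con.pwm_le) hd hd0) hnot

open PwmADP in
theorem mainTheorem3 {nx nu nξ K N : ℕ} (M : ControlProblem nx nu nξ)
    -- the optimal value function is real-valued
    (hfin : ∀ x, M.optCost x ≠ ⊤)
    -- continuous basis functions, including the constant, with well-defined expectations
    (φ : M.X → EuclideanSpace ℝ (Fin K))
    (hφ_cont : Continuous φ)
    (hφ_const : ∃ k, ∀ x, φ x k = 1)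
    (hφ_int : ∀ x u, Integrable (fun ξ => φ (M.g x u ξ)) M.P)
    (BI : Set (EuclideanSpace ℝ (Fin K)) → Set (EuclideanSpace ℝ (Fin K)))
    (hBI : IsConvexInnerApprox M φ BI)
    (hN : 0 < N) (xc : Fin N → M.X)
    (Aobj Acon : Set (EuclideanSpace ℝ (Fin K)))
    (hobj_fin : Aobj.Finite) (hobj_ne : Aobj.Nonempty)
    (hcon_fin : Acon.Finite) (hcon_ne : Acon.Nonempty)
    (hobj : ∀ x, pwm φ Aobj x ≤ M.Vstar x)
    (hcon : ∀ x, pwm φ Acon x ≤ M.Vstar x)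
    -- the linear program at each sample point attains its maximum
    (hLP : ∀ A : Set (EuclideanSpace ℝ (Fin K)), Acon ⊆ A → A.Finite →
      (∀ x, pwm φ A x ≤ M.Vstar x) → ∀ i, ∃ α, IsLPMax (BI A) (φ (xc i)) α)
    (εin εout : ℝ) (hεin : 0 < εin) (hεout : 0 < εout) :
    -- no execution is infinite
    (¬ ∃ s : ℕ → State K, s 0 = State.outer 0 Aobj Acon ∧
      ∀ n, Step φ xc BI εin εout (s n) (s (n + 1))) ∧
    -- the objective is non-decreasing and bounded above by the average of the value function
    (∀ s, Reachable φ xc BI εin εout Aobj Acon s →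
      avgObj φ xc s.Aobj ≤ (1 / (N : ℝ)) * ∑ i, M.Vstar (xc i) ∧
      ∀ s', Step φ xc BI εin εout s s' → avgObj φ xc s.Aobj ≤ avgObj φ xc s'.Aobj) ∧
    -- an execution stops only by returning, or at a refinement program without a maximizer
    (∀ s, Reachable φ xc BI εin εout Aobj Acon s →
      (∃ s', Step φ xc BI εin εout s s') ∨ (∃ Ao Ac, s = State.returned Ao Ac) ∨
      (∃ m fm i Ao Ac k α d, s = State.update m fm i Ao Ac k α d ∧ d ≠ 0 ∧
        ¬ ∃ β, IsLPMax (BI Ac) d β)) ∧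
    -- if the programs for sums over sample points are attained, executions stop only by returning
    ((∀ A : Set (EuclideanSpace ℝ (Fin K)), Acon ⊆ A → A.Finite →
        (∀ x, pwm φ A x ≤ M.Vstar x) → ∀ I : Finset (Fin N), I.Nonempty →
        ∃ α, IsLPMax (BI A) (∑ i ∈ I, φ (xc i)) α) →
      ∀ s, Reachable φ xc BI εin εout Aobj Acon s →
        (∃ s', Step φ xc BI εin εout s s') ∨ ∃ Ao Ac, s = State.returned Ao Ac) :=
  mainTheorem3_general (hBI.preservesLowerBounds hfin) xc ⟨hobj_fin, hobj_ne, hobj⟩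
    ⟨hcon_fin, hcon_ne, hcon⟩ hLP hεin hεout
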